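/- Let $X$ be a connected, locally path connected space, let $x_0\in X$, and suppose that $X$ is strong SLT at $x_0$: for every $x\in X$ and every neighbourhood $U$ of $x_0$ there is a neighbourhood $V$ of $x$ such that, for every path $\alpha$ from $x_0$ to $x$ and every loop $\beta$ in $V$ based at $x$, the loop $\alpha*\beta*\alpha^{-1}$ is homotopic relative to its endpoints to a loop in $U$ based at $x_0$. A pointed continuous map $p:(\widetilde X,\tilde x_0)\to(X,x_0)$ is called a generalized covering if $\widetilde X$ is connected and locally path connected and $p$ has the unique lifting property: for every connected, locally path connected pointed space $(Y,y_0)$ and every continuous $f:(Y,y_0)\to(X,x_0)$ with $f_*\pi_1(Y,y_0)\subseteq p_*\pi_1(\widetilde X,\tilde x_0)$ there is a unique continuous $\tilde f:(Y,y_0)\to(\widetilde X,\tilde x_0)$ with $p\circ\tilde f=f$. A subgroup $K\le\pi_1(X,x_0)$ is called a covering subgroup if $K=q_*\pi_1(E,e_0)$ for some covering map $q:(E,e_0)\to(X,x_0)$ with $E$ connected. Then for every subgroup $H\le\pi_1(X,x_0)$ the following are equivalent: 1. there is a generalized covering $p:(\widetilde X,\tilde x_0)\to(X,x_0)$ with $p_*\pi_1(\widetilde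 X,\tilde x_0)=H$; 2. $H$ is the intersection of a (nonempty) family of covering subgroups of $\pi_1(X,x_0)$. -/

import Mathlib

universe u

/-- The space `X` is a strong small loop transfer space at `x₀`: for every point `x` and every
neighbourhood `U` of `x₀` there is one neighbourhood `V` of `x` such that for every path `α` from
`x₀` to `x` and every loop `β` in `V` based at `x`, the loop `α * β * α⁻¹` is homotopic, relative
to the endpoints, to a loop in `U` based at `x₀`. -/
def StrongSLTAt (X : Type u) [TopologicalSpace X] (x₀ : X) : Prop :=
  ∀ x : X, ∀ U ∈ nhds x₀, ∃ V ∈ nhds x, ∀ (α : Path x₀ x) (β : Path x x),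
    Set.range β ⊆ V →
      ∃ γ : Path x₀ x₀, Set.range γ ⊆ U ∧ Path.Homotopic γ ((α.trans β).trans α.symm)

/-- The pointed map `p : (E, e₀) → (X, x₀)` has the unique lifting property: every pointed map
`f : (Y, y₀) → (X, x₀)` from a connected, locally path connected space with
`f_* π₁(Y, y₀) ⊆ p_* π₁(E, e₀)` has exactly one continuous lift `(Y, y₀) → (E, e₀)`. -/
def HasUniqueLiftingProperty {X E : Type u} [TopologicalSpace X] [TopologicalSpace E]
    (p : C(E, X)) (e₀ : E) (x₀ : X) (hp : p e₀ = x₀) : Prop :=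
  ∀ (Y : Type u) [TopologicalSpace Y] [ConnectedSpace Y] [LocallyPathConnectedSpace Y]
    (y₀ : Y) (f : C(Y, X)) (hf : f y₀ = x₀),
    (FundamentalGroup.mapOfEq f hf).range ≤ (FundamentalGroup.mapOfEq p hp).range →
      ∃! g : C(Y, E), g y₀ = e₀ ∧ p.comp g = f

/-- The pointed map `p : (E, e₀) → (X, x₀)` is a generalized covering map: `E` is connected and
locally path connected, and `p` has the unique lifting property. -/
structure IsGeneralizedCovering {X E : Type u} [TopologicalSpace X] [TopologicalSpace E]
    (p : C(E, X)) (e₀ : E) (x₀ : X) (hp : p e₀ = x₀) : Prop where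
  connectedSpace : ConnectedSpace E
  locallyPathConnectedSpace : LocallyPathConnectedSpace E
  uniqueLifting : HasUniqueLiftingProperty p e₀ x₀ hp

/-- The subgroup `K` of `π₁(X, x₀)` is a covering subgroup: it is `p_* π₁(E, e₀)` for some
covering map `p : (E, e₀) → (X, x₀)` with `E` connected. -/
def IsCoveringSubgroup {X : Type u} [TopologicalSpace X] (x₀ : X)
    (K : Subgroup (FundamentalGroup X x₀)) : Prop :=
  ∃ (E : Type u) (_ : TopologicalSpace E) (p : C(E, X)) (e₀ : E) (hp : p e₀ = x₀),
    ConnectedSpace E ∧ IsCoveringMap p ∧ (FundamentalGroup.mapOfEq p hp).range = K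

/-!
The candidate for the generalized covering belonging to `H` is the space of paths issuing from `x₀`
modulo `H`, with the whisker topology. It is a covering as soon as `H` absorbs small loops, and
conversely coverings force absorption. For an intersection of such subgroups, lifts into the path
space exist because a path can be appended to a path, and they are unique because they are unique
in the covering belonging to each member of the family.

Conversely, let `p` be a generalized covering with image subgroup `H`. Strong SLT at `x₀` says that
the normal core `N_U` of the group of classes of loops in `U` absorbs small loops, so the `H ⊔ N_U`
are covering subgroups, and it remains to see that their intersection is `H`. A class in all of them
lifts to a path from `e₀` to a point `e₁` which, for every `U`, is also the end of a lift of some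
loop in `U`. These loops together form a map from a contractible hedgehog whose arcs shrink to `x₀`.
Its lift is continuous, so `e₁` lies in every neighbourhood of `e₀`; uniqueness of path lifting does
not permit two such points in one fibre, so `e₁ = e₀` and the class lies in `H`.
-/

noncomputable section

open Set Filter Topology unitInterval

instance instLocallyPathConnectedSpaceUnitInterval : LocallyPathConnectedSpace I :=
  (convex_Icc 0 1).locallyPathConnectedSpace

instance instContractibleSpaceUnitInterval : ContractibleSpace I :=
  (convex_Icc 0 1).contractibleSpace ⟨0, unitInterval.zero_mem⟩

section LoopClass

variable {X : Type*} [TopologicalSpace X] {x₀ y z : X}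

/-- The class of the loop `a * b⁻¹` in `π₁(X, x₀)`; it measures by how much two paths from `x₀` to
`y` differ. -/
def loopClass (a b : Path x₀ y) : FundamentalGroup X x₀ :=
  Path.Homotopic.Quotient.mk (a.trans b.symm)

theorem loopClass_self (a : Path x₀ y) : loopClass a a = 1 :=
  Path.Homotopic.Quotient.eq.2 (Path.Homotopic.trans_symm a)

theorem loopClass_inv (a b : Path x₀ y) : (loopClass a b)⁻¹ = loopClass b a := by
  rw [loopClass, FundamentalGroup.inv_def, ← Path.Homotopic.Quotient.mk_symm, Path.trans_symm,
    Path.symm_symm, loopClass]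

theorem loopClass_mul (a b c : Path x₀ y) : loopClass b c * loopClass a b = loopClass a c := by
  simp only [loopClass, FundamentalGroup.mul_def, Path.Homotopic.Quotient.mk_trans,
    Path.Homotopic.Quotient.mk_symm, Path.Homotopic.Quotient.trans_assoc]
  rw [← Path.Homotopic.Quotient.trans_assoc (.symm (.mk b)),
    Path.Homotopic.Quotient.symm_trans, Path.Homotopic.Quotient.refl_trans]

theorem loopClass_trans_trans (a b : Path x₀ y) (ρ : Path y z) :
    loopClass (a.trans ρ) (b.trans ρ) = loopClass a b := by
  simp only [loopClass, Path.trans_symm, Path.Homotopic.Quotient.mk_trans,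
    Path.Homotopic.Quotient.mk_symm, Path.Homotopic.Quotient.trans_assoc]
  rw [← Path.Homotopic.Quotient.trans_assoc (.mk ρ),
    Path.Homotopic.Quotient.trans_symm, Path.Homotopic.Quotient.refl_trans]

theorem loopClass_eq_one {a b : Path x₀ y} (h : a.Homotopic b) : loopClass a b = 1 := by
  rw [← loopClass_self b]
  exact Path.Homotopic.Quotient.eq.2 (h.hcomp (.refl b.symm))

theorem loopClass_refl (a : Path x₀ x₀) :
    loopClass a (Path.refl x₀) = Path.Homotopic.Quotient.mk a :=
  Path.Homotopic.Quotient.eq.2 (Path.Homotopic.trans_refl a)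

end LoopClass

section Lifts

variable {X E : Type*} [TopologicalSpace X] [TopologicalSpace E] {p : C(E, X)}
  {e₀ e₁ e₂ : E} {x₀ x₁ x₂ : X}

theorem apply_trans_eq_trans_apply {a : Path e₀ e₁} {b : Path e₁ e₂} {α : Path x₀ x₁}
    {β : Path x₁ x₂} (ha : ∀ t, p (a t) = α t) (hb : ∀ t, p (b t) = β t) (t : I) :
    p (a.trans b t) = α.trans β t := by
  rw [Path.trans_apply, Path.trans_apply, apply_dite p]
  simp only [ha, hb]

theorem mem_range_mapOfEq_iff {hp : p e₀ = x₀} {g : FundamentalGroup X x₀} :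
    g ∈ (FundamentalGroup.mapOfEq p hp).range ↔
      ∃ (η : Path e₀ e₀) (γ : Path x₀ x₀), Path.Homotopic.Quotient.mk γ = g ∧
        ∀ t, p (η t) = γ t := by
  constructor
  · rintro ⟨k, rfl⟩
    obtain ⟨η, rfl⟩ := Path.Homotopic.Quotient.mk_surjective k
    refine ⟨η, (η.map p.continuous).cast hp.symm hp.symm, ?_, fun t => rfl⟩
    rw [FundamentalGroup.mapOfEq_apply]
    rfl
  · rintro ⟨η, γ, rfl, h⟩
    obtain rfl : (η.map p.continuous).cast hp.symm hp.symm = γ := Path.ext (funext h)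
    refine ⟨Path.Homotopic.Quotient.mk η, ?_⟩
    rw [FundamentalGroup.mapOfEq_apply]
    rfl

theorem exists_section_of_isCoveringMap (cov : IsCoveringMap p) (x : X) :
    ∃ V ∈ 𝓝 x, ∀ e, p e = x →
      ∃ s : C(V, E), (∀ v, p (s v) = v) ∧ ∀ v : V, (v : X) = x → s v = e := by
  obtain ⟨_, V, hxV, hV, _, φ, hφ⟩ := cov x
  refine ⟨V, hV.mem_nhds hxV, ?_⟩
  rintro e rfl
  let e' : p ⁻¹' V := ⟨e, hxV⟩
  refine ⟨⟨fun v => φ.symm (v, (φ e').2), by fun_prop⟩, fun v => ?_, fun v hv => ?_⟩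
  · change p (φ.symm (v, (φ e').2)) = v
    rw [← hφ, φ.apply_symm_apply]
  · have : (v, (φ e').2) = φ e' := Prod.ext (Subtype.ext (hv.trans (hφ e').symm)) rfl
    change (φ.symm (v, (φ e').2) : E) = e
    rw [this, φ.symm_apply_apply]

end Lifts

section AbsorbsSmallLoops

variable {X : Type*} [TopologicalSpace X] {x₀ : X} {H K : Subgroup (FundamentalGroup X x₀)}

/-- Every loop in `V` based at `x`, transported to `x₀` along any path, has its class in `K`. -/
def AbsorbsLoopsIn (K : Subgroup (FundamentalGroup X x₀)) (x : X) (V : Set X) : Prop :=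
  ∀ (α : Path x₀ x) (β : Path x x), range β ⊆ V → loopClass (α.trans β) α ∈ K

/-- Every point `x` has a neighbourhood whose loops based at `x` are absorbed by `K`. On a locally
path connected space these are exactly the subgroups corresponding to coverings. -/
def AbsorbsSmallLoops (K : Subgroup (FundamentalGroup X x₀)) : Prop :=
  ∀ x : X, ∃ V ∈ 𝓝 x, AbsorbsLoopsIn K x V

theorem AbsorbsSmallLoops.mono (h : AbsorbsSmallLoops H) (hHK : H ≤ K) : AbsorbsSmallLoops K :=
  fun x => let ⟨V, hV, hx⟩ := h x; ⟨V, hV, fun α β hβ => hHK (hx α β hβ)⟩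

theorem absorbsSmallLoops_range_of_isCoveringMap {E : Type*} [TopologicalSpace E] {p : C(E, X)}
    {e₀ : E} (hp : p e₀ = x₀) (cov : IsCoveringMap p) :
    AbsorbsSmallLoops (FundamentalGroup.mapOfEq p hp).range := by
  intro x
  obtain ⟨V, hV, hsection⟩ := exists_section_of_isCoveringMap cov x
  refine ⟨V, hV, fun α β hβ => ?_⟩
  obtain ⟨Γ, hΓ, hΓ₀⟩ := cov.exists_path_lifts α.toContinuousMap e₀ (by simp [hp])
  let a : Path e₀ (Γ 1) := ⟨Γ, hΓ₀, rfl⟩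
  have ha : ∀ t, p (a t) = α t := congrFun hΓ
  obtain ⟨s, hps, hsx⟩ := hsection (Γ 1) ((ha 1).trans α.target)
  have hβV : ∀ t, β t ∈ V := range_subset_iff.1 hβ
  let b : Path (Γ 1) (Γ 1) :=
    { toFun := fun t => s ⟨β t, hβV t⟩
      continuous_toFun := by fun_prop
      source' := hsx _ β.source
      target' := hsx _ β.target }
  have hab : ∀ t, p (a.trans b t) = α.trans β t := apply_trans_eq_trans_apply ha fun t => hps _
  exact mem_range_mapOfEq_iff.2
    ⟨_, _, rfl, apply_trans_eq_trans_apply (b := a.symm) hab fun t => ha _⟩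

end AbsorbsSmallLoops

section WhiskerSpace

variable {X : Type*} [TopologicalSpace X] {x₀ : X} {H K : Subgroup (FundamentalGroup X x₀)}

/-- Paths from `x₀` to `y` are equivalent modulo `H` when they differ by an element of `H`. -/
def whiskerSetoid (H : Subgroup (FundamentalGroup X x₀)) (y : X) : Setoid (Path x₀ y) where
  r a b := loopClass a b ∈ H
  iseqv :=
    { refl := fun a => loopClass_self a ▸ H.one_mem
      symm := fun {a b} h => loopClass_inv a b ▸ H.inv_mem h
      trans := fun {a b c} hab hbc => loopClass_mul a b c ▸ H.mul_mem hbc hab }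

/-- The space of paths issuing from `x₀`, modulo `H`, with the whisker topology: the candidate for
the generalized covering of `X` that belongs to `H`. -/
def WhiskerSpace (H : Subgroup (FundamentalGroup X x₀)) : Type _ :=
  Σ y : X, Quotient (whiskerSetoid H y)

namespace WhiskerSpace

/-- The class modulo `H` of a path issuing from `x₀`. -/
def mk (H : Subgroup (FundamentalGroup X x₀)) {y : X} (a : Path x₀ y) : WhiskerSpace H :=
  ⟨y, Quotient.mk _ a⟩

/-- The projection of `WhiskerSpace H` to `X`: the endpoint of a class of paths. -/
def proj (H : Subgroup (FundamentalGroup X x₀)) : WhiskerSpace H → X :=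
  Sigma.fst

theorem exists_rep_of_proj {z : WhiskerSpace H} {y : X} (h : proj H z = y) :
    ∃ a : Path x₀ y, z = mk H a := by
  obtain ⟨y, q⟩ := z
  obtain ⟨a, rfl⟩ := Quotient.exists_rep q
  subst h
  exact ⟨a, rfl⟩

theorem exists_rep (z : WhiskerSpace H) : ∃ (y : X) (a : Path x₀ y), z = mk H a :=
  ⟨_, exists_rep_of_proj rfl⟩

theorem mk_eq_mk_iff {y : X} {a b : Path x₀ y} : mk H a = mk H b ↔ loopClass a b ∈ H :=
  sigma_mk_injective.eq_iff.trans Quotient.eq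

theorem mk_eq_of_homotopic {y : X} {a b : Path x₀ y} (h : a.Homotopic b) : mk H a = mk H b :=
  mk_eq_mk_iff.2 (loopClass_eq_one h ▸ H.one_mem)

theorem mk_trans_eq_mk_trans_iff {y z : X} {a b : Path x₀ y} (ρ : Path y z) :
    mk H (a.trans ρ) = mk H (b.trans ρ) ↔ mk H a = mk H b := by
  rw [mk_eq_mk_iff, mk_eq_mk_iff, loopClass_trans_trans]

theorem mk_trans_assoc {w y z : X} (a : Path x₀ w) (ρ : Path w y) (τ : Path y z) :
    mk H ((a.trans ρ).trans τ) = mk H (a.trans (ρ.trans τ)) :=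
  mk_eq_of_homotopic (.trans_assoc a ρ τ)

theorem mk_trans_refl {y : X} (a : Path x₀ y) : mk H (a.trans (Path.refl y)) = mk H a :=
  mk_eq_of_homotopic (.trans_refl a)

theorem mk_refl_trans {y : X} (a : Path x₀ y) : mk H ((Path.refl x₀).trans a) = mk H a :=
  mk_eq_of_homotopic (.refl_trans a)

theorem mk_trans_symm_trans {y z : X} (a : Path x₀ z) (ρ : Path y z) :
    mk H ((a.trans ρ.symm).trans ρ) = mk H a := by
  rw [mk_trans_assoc]
  exact mk_eq_of_homotopic (((Path.Homotopic.refl a).hcomp (.symm_trans ρ)).trans (.trans_refl a))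

instance : TopologicalSpace (WhiskerSpace H) where
  IsOpen s := ∀ (y : X) (a : Path x₀ y), mk H a ∈ s →
    ∃ U ∈ 𝓝 y, ∀ (z : X) (ρ : Path y z), range ρ ⊆ U → mk H (a.trans ρ) ∈ s
  isOpen_univ _ _ _ := ⟨univ, univ_mem, fun _ _ _ => mem_univ _⟩
  isOpen_inter s t hs ht y a ha := by
    obtain ⟨U, hU, h⟩ := hs y a ha.1
    obtain ⟨V, hV, h'⟩ := ht y a ha.2
    exact ⟨U ∩ V, inter_mem hU hV, fun z ρ hρ =>
      ⟨h z ρ (hρ.trans inter_subset_left), h' z ρ (hρ.trans inter_subset_right)⟩⟩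
  isOpen_sUnion S hS y a ha := by
    obtain ⟨s, hs, ha⟩ := ha
    obtain ⟨U, hU, h⟩ := hS s hs y a ha
    exact ⟨U, hU, fun z ρ hρ => ⟨s, hs, h z ρ hρ⟩⟩

theorem continuous_proj : Continuous (proj H) where
  isOpen_preimage W hW _ _ ha :=
    ⟨W, hW.mem_nhds ha, fun _ ρ hρ => hρ ⟨1, ρ.target⟩⟩

/-- The projection of `WhiskerSpace H` to `X` as a bundled continuous map. -/
def projMap (H : Subgroup (FundamentalGroup X x₀)) : C(WhiskerSpace H, X) :=
  ⟨proj H, continuous_proj⟩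

theorem projMap_mk_refl (H : Subgroup (FundamentalGroup X x₀)) :
    projMap H (mk H (Path.refl x₀)) = x₀ := rfl

/-- The natural map between the whisker spaces of nested subgroups. -/
def map (h : H ≤ K) : WhiskerSpace H → WhiskerSpace K :=
  Sigma.map id fun _ => Quotient.map' id fun _ _ hab => h hab

theorem continuous_map (h : H ≤ K) : Continuous (map h) where
  isOpen_preimage _ hs y a ha := hs y a ha

theorem exists_continuous_lift {Y : Type*} [TopologicalSpace Y] [PathConnectedSpace Y]
    [LocallyPathConnectedSpace Y] {y₀ : Y} (f : C(Y, X)) (a : Path x₀ (f y₀))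
    (h : ∀ {y} (c d : Path y₀ y),
      mk H (a.trans (c.map f.continuous)) = mk H (a.trans (d.map f.continuous))) :
    ∃ g : C(Y, WhiskerSpace H),
      ∀ {y} (c : Path y₀ y), g y = mk H (a.trans (c.map f.continuous)) := by
  let g (y : Y) := mk H (a.trans ((PathConnectedSpace.somePath y₀ y).map f.continuous))
  have hg {y : Y} (c : Path y₀ y) : g y = mk H (a.trans (c.map f.continuous)) := h _ _
  refine ⟨⟨g, ⟨fun s hs => isOpen_iff_mem_nhds.2 fun y hy => ?_⟩⟩, hg⟩
  obtain ⟨U, hU, hUs⟩ := hs _ _ hy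
  filter_upwards [pathComponentIn_mem_nhds (f.continuous.continuousAt.preimage_mem_nhds hU)]
  rintro w ⟨τ, hτ⟩
  rw [mem_preimage, hg ((PathConnectedSpace.somePath y₀ y).trans τ), Path.map_trans,
    ← mk_trans_assoc]
  exact hUs _ (τ.map f.continuous) (range_subset_iff.2 hτ)

theorem exists_continuous_lift_of_range_le {Y : Type*} [TopologicalSpace Y] [PathConnectedSpace Y]
    [LocallyPathConnectedSpace Y] {y₀ : Y} (f : C(Y, X)) (hf : f y₀ = x₀)
    (hle : (FundamentalGroup.mapOfEq f hf).range ≤ H) :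
    ∃ g : C(Y, WhiskerSpace H), g y₀ = mk H (Path.refl x₀) ∧ (projMap H).comp g = f := by
  subst hf
  obtain ⟨g, hg⟩ := exists_continuous_lift f (Path.refl _) fun c d => by
    rw [mk_refl_trans, mk_refl_trans, mk_eq_mk_iff]
    refine hle (mem_range_mapOfEq_iff.2 ⟨c.trans d.symm, _, rfl, ?_⟩)
    exact apply_trans_eq_trans_apply (fun _ => rfl) fun _ => rfl
  refine ⟨g, ?_, ?_⟩
  · exact (hg (Path.refl y₀)).trans (mk_trans_refl _)
  · ext y
    exact congrArg (proj H) (hg (PathConnectedSpace.somePath y₀ y))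

theorem exists_path_mk_trans {x z : X} (a : Path x₀ x) (ρ : Path x z) :
    ∃ η : Path (mk H a) (mk H (a.trans ρ)),
      ∀ t, ∃ τ : Path x (ρ t), range τ ⊆ range ρ ∧ η t = mk H (a.trans τ) := by
  obtain ⟨f, rfl, rfl⟩ := ρ
  obtain ⟨g, hg⟩ := exists_continuous_lift (H := H) f a fun c d => mk_eq_of_homotopic <|
    (Path.Homotopic.refl a).hcomp ((SimplyConnectedSpace.paths_homotopic c d).map f)
  let c (t : I) : Path 0 t := PathConnectedSpace.somePath 0 t
  exact ⟨⟨g, (hg (Path.refl 0)).trans (mk_trans_refl a), hg ⟨ContinuousMap.id I, rfl, rfl⟩⟩,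
    fun t => ⟨(c t).map f.continuous, range_comp_subset_range (c t) f, hg (c t)⟩⟩

/-- The classes obtained from `a` by appending a path in `V`. -/
def sheet (H : Subgroup (FundamentalGroup X x₀)) {x : X} (a : Path x₀ x) (V : Set X) :
    Set (WhiskerSpace H) :=
  {w | ∃ (z : X) (ρ : Path x z), range ρ ⊆ V ∧ w = mk H (a.trans ρ)}

theorem mk_mem_sheet {x : X} (a : Path x₀ x) {V : Set X} (hx : x ∈ V) : mk H a ∈ sheet H a V :=
  ⟨x, Path.refl x, by simpa using hx, (mk_trans_refl a).symm⟩

theorem isOpen_sheet {x : X} (a : Path x₀ x) {V : Set X} (hV : IsOpen V) :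
    IsOpen (sheet H a V) := by
  rintro y b ⟨z, ρ, hρ, hb⟩
  obtain rfl : y = z := congrArg (proj H) hb
  refine ⟨V, hV.mem_nhds (hρ ⟨1, ρ.target⟩), fun w τ hτ => ⟨w, ρ.trans τ, ?_, ?_⟩⟩
  · rw [Path.trans_range]
    exact union_subset hρ hτ
  · rw [← mk_trans_assoc, mk_trans_eq_mk_trans_iff, hb]

theorem isPathConnected_sheet {x : X} (a : Path x₀ x) {V : Set X} (hx : x ∈ V) :
    IsPathConnected (sheet H a V) := by
  refine ⟨mk H a, mk_mem_sheet a hx, ?_⟩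
  rintro _ ⟨z, ρ, hρ, rfl⟩
  obtain ⟨η, hη⟩ := exists_path_mk_trans (H := H) a ρ
  refine ⟨η, fun t => ?_⟩
  obtain ⟨τ, hτ, h⟩ := hη t
  exact ⟨_, τ, hτ.trans hρ, h⟩

theorem exists_path_mk_refl_mk {y : X} (a : Path x₀ y) :
    ∃ η : Path (mk H (Path.refl x₀)) (mk H a), ∀ t, proj H (η t) = a t := by
  obtain ⟨η, hη⟩ := exists_path_mk_trans (H := H) (Path.refl x₀) a
  refine ⟨η.cast rfl (mk_refl_trans a).symm, fun t => ?_⟩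
  obtain ⟨τ, -, h⟩ := hη t
  exact congrArg (proj H) h

instance : PathConnectedSpace (WhiskerSpace H) where
  nonempty := ⟨mk H (Path.refl x₀)⟩
  joined z w := by
    obtain ⟨y, a, rfl⟩ := exists_rep z
    obtain ⟨y, b, rfl⟩ := exists_rep w
    obtain ⟨η, -⟩ := exists_path_mk_refl_mk (H := H) a
    obtain ⟨θ, -⟩ := exists_path_mk_refl_mk (H := H) b
    exact ⟨η.symm.trans θ⟩

instance : LocallyPathConnectedSpace (WhiskerSpace H) := by
  rw [locallyPathConnectedSpace_iff_pathComponentIn_mem_nhds]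
  intro w s hs hw
  obtain ⟨x, a, rfl⟩ := exists_rep w
  obtain ⟨U, hU, hUs⟩ := hs x a hw
  obtain ⟨V, hVU, hV, hxV⟩ := mem_nhds_iff.1 hU
  refine mem_of_superset ((isOpen_sheet a hV).mem_nhds (mk_mem_sheet a hxV)) ?_
  refine (isPathConnected_sheet a hxV).subset_pathComponentIn (mk_mem_sheet a hxV) ?_
  rintro _ ⟨z, ρ, hρ, rfl⟩
  exact hUs z ρ (hρ.trans hVU)

theorem le_range_projMap :
    H ≤ (FundamentalGroup.mapOfEq (projMap H) (projMap_mk_refl H)).range := by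
  intro g hg
  obtain ⟨a, rfl⟩ := Path.Homotopic.Quotient.mk_surjective g
  have ha : mk H (Path.refl x₀) = mk H a := by
    rwa [eq_comm, mk_eq_mk_iff, loopClass_refl]
  obtain ⟨η, hη⟩ := exists_path_mk_refl_mk (H := H) a
  exact mem_range_mapOfEq_iff.2 ⟨η.cast rfl ha, a, rfl, hη⟩

section CoveringMap

variable {x : X} {V : Set X}

theorem mk_trans_eq_mk_trans_iff_of_absorbsLoopsIn (hV : AbsorbsLoopsIn H x V) {z : X}
    {a b : Path x₀ x} {ρ τ : Path x z} (hρ : range ρ ⊆ V) (hτ : range τ ⊆ V) :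
    mk H (a.trans ρ) = mk H (b.trans τ) ↔ mk H a = mk H b := by
  have hloop : mk H (a.trans (ρ.trans τ.symm)) = mk H a := by
    refine mk_eq_mk_iff.2 (hV a _ ?_)
    rw [Path.trans_range, Path.symm_range]
    exact union_subset hρ hτ
  have hρτ : mk H (a.trans ρ) = mk H (a.trans τ) := by
    rw [← mk_trans_symm_trans (a.trans ρ) τ, mk_trans_eq_mk_trans_iff, mk_trans_assoc, hloop]
  rw [hρτ, mk_trans_eq_mk_trans_iff]

theorem injOn_proj_sheet (hV : AbsorbsLoopsIn H x V) (a : Path x₀ x) :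
    InjOn (proj H) (sheet H a V) := by
  rintro _ ⟨z, ρ, hρ, rfl⟩ _ ⟨z', τ, hτ, rfl⟩ h
  obtain rfl : z = z' := h
  exact (mk_trans_eq_mk_trans_iff_of_absorbsLoopsIn hV hρ hτ).2 rfl

theorem disjoint_sheet_of_mk_ne (hV : AbsorbsLoopsIn H x V) {a b : Path x₀ x}
    (hab : mk H a ≠ mk H b) : Disjoint (sheet H a V) (sheet H b V) := by
  refine Set.disjoint_left.2 ?_
  rintro _ ⟨z, ρ, hρ, rfl⟩ ⟨z', τ, hτ, h⟩
  obtain rfl : z = z' := congrArg (proj H) h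
  exact hab ((mk_trans_eq_mk_trans_iff_of_absorbsLoopsIn hV hρ hτ).1 h)

theorem surjOn_proj_sheet (hV : ∀ z ∈ V, JoinedIn V x z) (a : Path x₀ x) :
    SurjOn (proj H) (sheet H a V) V := fun z hz =>
  let ⟨ρ, hρ⟩ := hV z hz
  ⟨_, ⟨z, ρ, range_subset_iff.2 hρ, rfl⟩, rfl⟩

theorem exists_mem_sheet_of_proj_mem (hV : ∀ z ∈ V, JoinedIn V x z) {w : WhiskerSpace H}
    (hw : proj H w ∈ V) : ∃ a : Path x₀ x, w ∈ sheet H a V := by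
  obtain ⟨z, b, rfl⟩ := exists_rep w
  obtain ⟨ρ, hρ⟩ := hV z hw
  exact ⟨b.trans ρ.symm, z, ρ, range_subset_iff.2 hρ, (mk_trans_symm_trans b ρ).symm⟩

theorem sheet_congr {a b : Path x₀ x} (h : mk H a = mk H b) (V : Set X) :
    sheet H a V = sheet H b V := by
  ext w
  refine exists₂_congr fun z ρ => and_congr_right' ?_
  rw [(mk_trans_eq_mk_trans_iff ρ).2 h]

theorem isOpen_iff_isOpen_preimage_inter_sheet [LocallyPathConnectedSpace X] (hVo : IsOpen V)
    (hV : ∀ z ∈ V, JoinedIn V x z) (a : Path x₀ x) {W : Set X} (hW : W ⊆ V) :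
    IsOpen W ↔ IsOpen (proj H ⁻¹' W ∩ sheet H a V) := by
  refine ⟨fun h => (h.preimage continuous_proj).inter (isOpen_sheet a hVo), fun h => ?_⟩
  refine isOpen_iff_mem_nhds.2 fun z hz => ?_
  obtain ⟨ρ, hρ⟩ := hV z (hW hz)
  obtain ⟨U, hU, hUW⟩ := h z (a.trans ρ) ⟨hz, z, ρ, range_subset_iff.2 hρ, rfl⟩
  filter_upwards [pathComponentIn_mem_nhds hU]
  rintro w ⟨τ, hτ⟩
  exact (hUW w τ (range_subset_iff.2 hτ)).1

theorem isEvenlyCovered_proj [LocallyPathConnectedSpace X] (hVo : IsOpen V) (hx : x ∈ V)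
    (hVc : ∀ z ∈ V, JoinedIn V x z) (hV : AbsorbsLoopsIn H x V) :
    IsEvenlyCovered (proj H) x (proj H ⁻¹' {x}) := by
  let : TopologicalSpace (Quotient (whiskerSetoid H x)) := ⊥
  have : DiscreteTopology (Quotient (whiskerSetoid H x)) := ⟨rfl⟩
  suffices IsEvenlyCovered (proj H) x (Quotient (whiskerSetoid H x)) from
    this.to_isEvenlyCovered_preimage
  have mk_out (q : Quotient (whiskerSetoid H x)) : mk H q.out = ⟨x, q⟩ :=
    congrArg (Sigma.mk x) q.out_eq
  have hcover : proj H ⁻¹' V ⊆ ⋃ q : Quotient (whiskerSetoid H x), sheet H q.out V := by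
    intro w hw
    obtain ⟨a, ha⟩ := exists_mem_sheet_of_proj_mem hVc hw
    exact mem_iUnion.2 ⟨Quotient.mk _ a, sheet_congr (mk_out _).symm V ▸ ha⟩
  rcases isEmpty_or_nonempty (Quotient (whiskerSetoid H x)) with _ | _
  · refine .of_preimage_eq_empty _ (hVo.mem_nhds hx) (subset_empty_iff.1 (hcover.trans ?_))
    rw [iUnion_of_empty]
  have : Nonempty (X → WhiskerSpace H) := ⟨fun _ => mk H (Path.refl x₀)⟩
  refine .of_trivialization (t := IsOpen.trivializationDiscrete
    (fun q : Quotient (whiskerSetoid H x) => sheet H q.out V) V hVo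
    (fun _ _ => isOpen_iff_isOpen_preimage_inter_sheet hVo hVc _)
    (fun _ => injOn_proj_sheet hV _) (fun _ => surjOn_proj_sheet hVc _)
    (fun q r hqr => disjoint_sheet_of_mk_ne hV ?_) hcover) hx
  rw [mk_out, mk_out]
  exact sigma_mk_injective.ne hqr

theorem isCoveringMap_proj [LocallyPathConnectedSpace X] (hH : AbsorbsSmallLoops H) :
    IsCoveringMap (proj H) := by
  intro x
  obtain ⟨U, hU, hUH⟩ := hH x
  obtain ⟨V, ⟨hV, hxV, hVc⟩, hVU⟩ := (isOpen_isPathConnected_basis x).mem_iff.1 hU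
  exact isEvenlyCovered_proj hV hxV (hVc.joinedIn x hxV) fun α β hβ => hUH α β (hβ.trans hVU)

end CoveringMap

section Intersection

variable {S : Set (Subgroup (FundamentalGroup X x₀))}

theorem eq_of_forall_map_eq {z w : WhiskerSpace (sInf S)} (h : proj _ z = proj _ w)
    (hS : ∀ K (hK : K ∈ S), map (sInf_le hK) z = map (sInf_le hK) w) : z = w := by
  obtain ⟨y, a, rfl⟩ := exists_rep z
  obtain ⟨b, rfl⟩ := exists_rep_of_proj (y := y) h.symm
  rw [mk_eq_mk_iff, Subgroup.mem_sInf]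
  exact fun K hK => mk_eq_mk_iff.1 (hS K hK)

theorem eq_of_projMap_comp_eq [LocallyPathConnectedSpace X] (hS : ∀ K ∈ S, AbsorbsSmallLoops K)
    {Y : Type*} [TopologicalSpace Y] [PreconnectedSpace Y] {f g : C(Y, WhiskerSpace (sInf S))}
    (h : (projMap _).comp f = (projMap _).comp g) {y₀ : Y} (h₀ : f y₀ = g y₀) : f = g := by
  ext y
  refine eq_of_forall_map_eq (DFunLike.congr_fun h y) fun K hK => ?_
  have hlift : map (sInf_le hK) ∘ f = map (sInf_le hK) ∘ g :=
    (isCoveringMap_proj (hS K hK)).eq_of_comp_eq ((continuous_map _).comp f.continuous)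
      ((continuous_map _).comp g.continuous) (funext (DFunLike.congr_fun h)) y₀
      (congrArg (map _) h₀)
  exact congrFun hlift y

theorem range_projMap_sInf [LocallyPathConnectedSpace X] (hS : ∀ K ∈ S, AbsorbsSmallLoops K) :
    (FundamentalGroup.mapOfEq (projMap (sInf S)) (projMap_mk_refl _)).range = sInf S := by
  refine le_antisymm (fun g hg => ?_) le_range_projMap
  obtain ⟨η, γ, rfl, hη⟩ := mem_range_mapOfEq_iff.1 hg
  obtain ⟨θ, hθ⟩ := exists_path_mk_refl_mk (H := sInf S) γ
  have hθη : θ.toContinuousMap = η.toContinuousMap :=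
    eq_of_projMap_comp_eq hS (ContinuousMap.ext fun t => (hθ t).trans (hη t).symm) (y₀ := 0)
      (θ.source.trans η.source.symm)
  have hγ : mk (sInf S) γ = mk (sInf S) (Path.refl x₀) :=
    θ.target.symm.trans ((DFunLike.congr_fun hθη 1).trans η.target)
  rwa [mk_eq_mk_iff, loopClass_refl] at hγ

end Intersection

end WhiskerSpace

end WhiskerSpace

section Existence

variable {X : Type u} [TopologicalSpace X] [LocallyPathConnectedSpace X] {x₀ : X}

theorem isGeneralizedCovering_projMap_sInf {S : Set (Subgroup (FundamentalGroup X x₀))}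
    (hS : ∀ K ∈ S, AbsorbsSmallLoops K) :
    IsGeneralizedCovering (WhiskerSpace.projMap (sInf S)) (WhiskerSpace.mk _ (Path.refl x₀)) x₀
      (WhiskerSpace.projMap_mk_refl _) where
  connectedSpace := inferInstance
  locallyPathConnectedSpace := inferInstance
  uniqueLifting Y _ _ _ y₀ f hf hle := by
    have : PathConnectedSpace Y := .of_locallyPathConnectedSpace
    rw [WhiskerSpace.range_projMap_sInf hS] at hle
    obtain ⟨g, hg₀, hg⟩ := WhiskerSpace.exists_continuous_lift_of_range_le f hf hle
    exact ⟨g, ⟨hg₀, hg⟩, fun g' hg' =>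
      WhiskerSpace.eq_of_projMap_comp_eq hS (hg'.2.trans hg.symm) (hg'.1.trans hg₀.symm)⟩

theorem isCoveringSubgroup_of_absorbsSmallLoops {K : Subgroup (FundamentalGroup X x₀)}
    (hK : AbsorbsSmallLoops K) : IsCoveringSubgroup x₀ K := by
  have hrange := WhiskerSpace.range_projMap_sInf (S := {K}) (by simpa using hK)
  rw [sInf_singleton] at hrange
  exact ⟨WhiskerSpace K, inferInstance, WhiskerSpace.projMap K, WhiskerSpace.mk K (Path.refl x₀),
    WhiskerSpace.projMap_mk_refl K, inferInstance, WhiskerSpace.isCoveringMap_proj hK, hrange⟩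

end Existence

/-- A family of arcs issuing from a common point, for the lifting of infinitely many paths at once:
the arcs become small along the filter `l`, in that a neighbourhood of the common point contains
almost all of them. The starting points of the arcs are not identified but only made topologically
inseparable, so that the underlying type is a product. -/
def Hedgehog {ι : Type*} (_ : Filter ι) : Type _ :=
  ι × I

namespace Hedgehog

variable {ι : Type*} {l : Filter ι}

/-- The point of parameter `t` on the arc of index `i`. -/
def mk (l : Filter ι) (i : ι) (t : I) : Hedgehog l :=
  (i, t)

theorem mk_injective (i : ι) : Function.Injective (mk l i) :=
  Prod.mk_right_injective i

instance : TopologicalSpace (Hedgehog l) where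
  IsOpen s := (∀ i, IsOpen (mk l i ⁻¹' s)) ∧
    ∀ i, mk l i 0 ∈ s → (∀ j, mk l j 0 ∈ s) ∧ ∀ᶠ j in l, ∀ t, mk l j t ∈ s
  isOpen_univ := ⟨fun _ => isOpen_univ,
    fun _ _ => ⟨fun _ => trivial, .of_forall fun _ _ => trivial⟩⟩
  isOpen_inter s t hs ht := by
    refine ⟨fun i => (hs.1 i).inter (ht.1 i), fun i hi => ?_⟩
    obtain ⟨hs₀, hsl⟩ := hs.2 i hi.1
    obtain ⟨ht₀, htl⟩ := ht.2 i hi.2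
    exact ⟨fun j => ⟨hs₀ j, ht₀ j⟩, (hsl.and htl).mono fun j hj r => ⟨hj.1 r, hj.2 r⟩⟩
  isOpen_sUnion S hS := by
    refine ⟨fun i => ?_, fun i ⟨s, hs, hi⟩ => ?_⟩
    · rw [preimage_sUnion]
      exact isOpen_biUnion fun s hs => (hS s hs).1 i
    · obtain ⟨hs₀, hsl⟩ := (hS s hs).2 i hi
      exact ⟨fun j => ⟨s, hs, hs₀ j⟩, hsl.mono fun j hj t => ⟨s, hs, hj t⟩⟩

theorem continuous_mk (i : ι) : Continuous (mk l i) :=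
  ⟨fun _ hs => hs.1 i⟩

theorem inseparable_mk_zero (i j : ι) : Inseparable (mk l i 0) (mk l j 0) :=
  inseparable_iff_forall_isOpen.2 fun _ hs =>
    ⟨fun h => (hs.2 i h).1 j, fun h => (hs.2 j h).1 i⟩

theorem tendsto_mk (i : ι) (t : I) : Tendsto (fun j => mk l j t) l (𝓝 (mk l i 0)) :=
  tendsto_nhds.2 fun _ hs h => (hs.2 i h).2.mono fun _ hj => hj t

theorem nhds_mk (i : ι) {t : I} (ht : t ≠ 0) : 𝓝 (mk l i t) = map (mk l i) (𝓝 t) := by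
  refine le_antisymm (fun s hs => ?_) (continuous_mk i).continuousAt
  obtain ⟨W, hWs, hW, htW⟩ := mem_nhds_iff.1 hs
  refine mem_nhds_iff.2 ⟨mk l i '' (W ∩ {0}ᶜ), ?_, ⟨fun j => ?_, ?_⟩, t, ⟨htW, ht⟩, rfl⟩
  · exact image_subset_iff.2 (inter_subset_left.trans hWs)
  · rcases eq_or_ne i j with rfl | hij
    · rw [preimage_image_eq _ (mk_injective i)]
      exact hW.inter isOpen_compl_singleton
    · rw [show mk l j ⁻¹' (mk l i '' (W ∩ {0}ᶜ)) = ∅ from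
        eq_empty_of_forall_notMem fun _ ⟨_, _, h⟩ => hij (congrArg Prod.fst h)]
      exact isOpen_empty
  · rintro j ⟨r, hr, h⟩
    exact absurd (congrArg Prod.snd h) hr.2

theorem continuous_of_forall_eventually_mem {X : Type*} [TopologicalSpace X] {x : X}
    {f : ι → I → X} (hf : ∀ i, Continuous (f i)) (hx : ∀ i, f i 0 = x)
    (hl : ∀ U ∈ 𝓝 x, ∀ᶠ i in l, ∀ t, f i t ∈ U) :
    Continuous fun z : Hedgehog l => f z.1 z.2 := by
  refine ⟨fun U hU => ⟨fun i => hU.preimage (hf i), fun i hi => ?_⟩⟩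
  have hxU : x ∈ U := hx i ▸ hi
  exact ⟨fun j => (hx j ▸ hxU :), hl U (hU.mem_nhds hxU)⟩

/-- The points of `s` that are joined to the start of their arc by a segment in `s`. -/
def star (s : Set (Hedgehog l)) : Set (Hedgehog l) :=
  {z | ∀ r, mk l z.1 (min r z.2) ∈ s}

theorem mk_mem_star {s : Set (Hedgehog l)} {i : ι} {t : I} :
    mk l i t ∈ star s ↔ ∀ r, mk l i (min r t) ∈ s := Iff.rfl

theorem mk_zero_mem_star {s : Set (Hedgehog l)} {i : ι} : mk l i 0 ∈ star s ↔ mk l i 0 ∈ s := by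
  simp only [mk_mem_star, min_eq_right nonneg', forall_const]

theorem isOpen_star {s : Set (Hedgehog l)} (hs : IsOpen s) : IsOpen (star s) := by
  refine ⟨fun i => isOpen_iff_mem_nhds.2 fun t ht => ?_, fun i hi => ?_⟩
  · have hcont : Continuous fun q : I × I => mk l i (min q.2 q.1) :=
      (continuous_mk i).comp (continuous_snd.min continuous_fst)
    have hnear : ∀ᶠ t' in 𝓝 t, ∀ r ∈ univ, mk l i (min r t') ∈ s :=
      isCompact_univ.eventually_forall_of_forall_eventually fun r _ =>
        (hs.preimage hcont).mem_nhds (ht r)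
    exact hnear.mono fun t' ht' r => ht' r trivial
  · obtain ⟨hs₀, hsl⟩ := hs.2 i (mk_zero_mem_star.1 hi)
    exact ⟨fun j => mk_zero_mem_star.2 (hs₀ j), hsl.mono fun j hj _ _ => hj _⟩

theorem continuous_mk_min : Continuous fun q : I × Hedgehog l => mk l q.2.1 (min q.1 q.2.2) := by
  refine continuous_iff_continuousAt.2 ?_
  rintro ⟨r, i, t⟩
  rcases eq_or_ne t 0 with rfl | ht
  · refine tendsto_nhds.2 fun s hs hz => ?_
    have hi : mk l i 0 ∈ s := by rwa [← min_eq_right (nonneg' (t := r))]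
    have hstar : star s ∈ 𝓝 (mk l i 0) := (isOpen_star hs).mem_nhds (mk_zero_mem_star.2 hi)
    filter_upwards [prod_mem_nhds univ_mem hstar] with q hq
    exact hq.2 q.1
  · have hnhds : 𝓝 ((r, mk l i t) : I × Hedgehog l) = map (Prod.map id (mk l i)) (𝓝 (r, t)) := by
      rw [nhds_prod_eq, nhds_prod_eq, nhds_mk i ht, ← prod_map_map_eq', map_id]
    change Tendsto _ (𝓝 (r, mk l i t)) _
    rw [hnhds, tendsto_map'_iff]
    exact ((continuous_mk i).comp (continuous_fst.min continuous_snd)).continuousAt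

instance [Nonempty ι] : ContractibleSpace (Hedgehog l) := by
  classical
  let i₀ : ι := Classical.arbitrary ι
  rw [contractible_iff_id_nullhomotopic]
  refine ⟨mk l i₀ 0, ⟨ContinuousMap.Homotopy.symm
    { toFun := fun q => if q.1 = 0 then mk l i₀ 0 else mk l q.2.1 (min q.1 q.2.2)
      continuous_toFun := (continuous_congr_of_inseparable fun q => ?_).2 continuous_mk_min
      map_zero_left := fun z => if_pos rfl
      map_one_left := fun z => ?_ }⟩⟩
  · split_ifs with h
    · rw [h, min_eq_left nonneg']
      exact inseparable_mk_zero _ _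
    · rfl
  · rw [if_neg one_ne_zero, min_eq_right le_one']
    rfl

theorem joinedIn_mk_zero_of_mem_star {s : Set (Hedgehog l)} {i : ι} {t : I}
    (h : mk l i t ∈ star s) : JoinedIn s (mk l i 0) (mk l i t) :=
  ⟨⟨⟨fun r => mk l i (min r t), (continuous_mk i).comp (by fun_prop)⟩,
    congrArg (mk l i) (min_eq_left nonneg'), congrArg (mk l i) (min_eq_right le_one')⟩, h⟩

instance : LocallyPathConnectedSpace (Hedgehog l) := by
  rw [locallyPathConnectedSpace_iff_pathComponentIn_mem_nhds]
  rintro ⟨i, t⟩ s hs hz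
  rcases eq_or_ne t 0 with rfl | ht
  · filter_upwards [(isOpen_star hs).mem_nhds (mk_zero_mem_star.2 hz)]
    rintro ⟨j, t⟩ hj
    exact ((inseparable_mk_zero i j).joinedIn hz ((hs.2 i hz).1 j)).trans
      (joinedIn_mk_zero_of_mem_star hj)
  · change _ ∈ 𝓝 (mk l i t)
    rw [nhds_mk i ht, mem_map]
    refine mem_of_superset (pathComponentIn_mem_nhds ((hs.1 i).mem_nhds hz)) ?_
    rintro r ⟨c, hc⟩
    exact ⟨c.map (continuous_mk i), hc⟩

end Hedgehog

section UniqueLifting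

theorem eq_of_trans_apply_eq {X : Type*} [TopologicalSpace X] {x y z z' : X} {c : Path x y}
    {a : Path y z} {b : Path y z'} (h : ∀ t, c.trans a t = c.trans b t) (t : I) : a t = b t := by
  have ht : ((1 + t : ℝ) / 2) ∈ I := ⟨by linarith [t.2.1], by linarith [t.2.2]⟩
  have ht₂ : (1 / 2 : ℝ) ≤ (1 + t) / 2 := by linarith [t.2.1]
  have hext : (c.trans a).extend ((1 + t) / 2) = (c.trans b).extend ((1 + t) / 2) := by
    rw [Path.extend_apply _ ht, Path.extend_apply _ ht, h]
  rwa [Path.extend_trans_of_half_le _ _ ht₂, Path.extend_trans_of_half_le _ _ ht₂,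
    show 2 * ((1 + t : ℝ) / 2) - 1 = t by ring, Path.extend_apply _ t.2,
    Path.extend_apply _ t.2] at hext

variable {X E : Type u} [TopologicalSpace X] [TopologicalSpace E] {p : C(E, X)} {e₀ : E} {x₀ : X}
  {hp : p e₀ = x₀}

namespace HasUniqueLiftingProperty

theorem existsUnique_lift (h : HasUniqueLiftingProperty p e₀ x₀ hp) {Y : Type u}
    [TopologicalSpace Y] [SimplyConnectedSpace Y] [LocallyPathConnectedSpace Y] {y₀ : Y}
    (f : C(Y, X)) (hf : f y₀ = x₀) : ∃! g : C(Y, E), g y₀ = e₀ ∧ p.comp g = f := by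
  refine h Y y₀ f hf ?_
  rintro _ ⟨k, rfl⟩
  rw [Subsingleton.elim k 1, map_one]
  exact one_mem _

theorem existsUnique_lift_of_contractible (h : HasUniqueLiftingProperty p e₀ x₀ hp) {Y : Type}
    [TopologicalSpace Y] [ContractibleSpace Y] [LocallyPathConnectedSpace Y] {y₀ : Y}
    (f : C(Y, X)) (hf : f y₀ = x₀) : ∃! g : C(Y, E), g y₀ = e₀ ∧ p.comp g = f := by
  have : ContractibleSpace (ULift.{u} Y) := Homeomorph.ulift.contractibleSpace
  have : LocallyPathConnectedSpace (ULift.{u} Y) :=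
    Homeomorph.ulift.isOpenEmbedding.locallyPathConnectedSpace
  let up : C(Y, ULift.{u} Y) := ⟨ULift.up, continuous_uliftUp⟩
  let down : C(ULift.{u} Y, Y) := ⟨ULift.down, continuous_uliftDown⟩
  obtain ⟨g, ⟨hg₀, hg⟩, huniq⟩ := h.existsUnique_lift (y₀ := ULift.up y₀) (f.comp down) hf
  refine ⟨g.comp up, ⟨hg₀, ?_⟩, ?_⟩
  · rw [← ContinuousMap.comp_assoc, hg]
    rfl
  · rintro g' ⟨hg'₀, hg'⟩
    rw [← huniq (g'.comp down) ⟨hg'₀, by rw [← ContinuousMap.comp_assoc, hg']⟩]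
    rfl

theorem exists_path_lift (h : HasUniqueLiftingProperty p e₀ x₀ hp) {x : X} (α : Path x₀ x) :
    ∃ (e : E) (a : Path e₀ e), ∀ t, p (a t) = α t := by
  obtain ⟨g, ⟨hg₀, hg⟩, -⟩ := h.existsUnique_lift_of_contractible (y₀ := (0 : I))
    α.toContinuousMap α.source
  exact ⟨g 1, ⟨g, hg₀, rfl⟩, DFunLike.congr_fun hg⟩

theorem eq_of_comp_eq_of_base (h : HasUniqueLiftingProperty p e₀ x₀ hp) {η θ : C(I, E)}
    (hη : η 0 = e₀) (hθ : θ 0 = e₀) (hηθ : ∀ t, p (η t) = p (θ t)) : η = θ :=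
  (h.existsUnique_lift_of_contractible (y₀ := (0 : I)) (p.comp θ) (by simp [hθ, hp])).unique
    ⟨hη, ContinuousMap.ext hηθ⟩ ⟨hθ, rfl⟩

variable [PathConnectedSpace E]

theorem eq_of_comp_eq (h : HasUniqueLiftingProperty p e₀ x₀ hp) {η θ : C(I, E)} (h₀ : η 0 = θ 0)
    (hηθ : ∀ t, p (η t) = p (θ t)) : η = θ := by
  let c : Path e₀ (η 0) := PathConnectedSpace.somePath _ _
  let a : Path (η 0) (η 1) := ⟨η, rfl, rfl⟩
  let b : Path (η 0) (θ 1) := ⟨θ, h₀.symm, rfl⟩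
  have hcab : (c.trans a).toContinuousMap = (c.trans b).toContinuousMap :=
    h.eq_of_comp_eq_of_base (c.trans a).source (c.trans b).source fun t => by
      simp only [Path.coe_toContinuousMap, Path.trans_apply]
      split_ifs
      · rfl
      · exact hηθ _
  exact ContinuousMap.ext (eq_of_trans_apply_eq (a := a) (b := b) (c := c) fun t =>
    DFunLike.congr_fun hcab t)

theorem eq_of_specializes (h : HasUniqueLiftingProperty p e₀ x₀ hp) {e e' : E} (hs : e ⤳ e')
    (he : p e = p e') : e = e' := by
  classical
  -- The jump from `e` to `e'` at time `1` is continuous and lifts a constant path.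
  let η : C(I, E) := ⟨({1} : Set I).piecewise (fun _ => e') fun _ => e,
    isClosed_singleton.continuous_piecewise_of_specializes continuous_const continuous_const
      fun _ => hs⟩
  have hη : η = ContinuousMap.const I e := by
    refine h.eq_of_comp_eq (by simp [η]) fun t => ?_
    by_cases ht : t = 1 <;> simp [η, ht, he]
  simpa [η] using (DFunLike.congr_fun hη 1).symm

theorem eq_of_homotopic (h : HasUniqueLiftingProperty p e₀ x₀ hp) {x : X} {α β : Path x₀ x}
    (hαβ : α.Homotopic β) {e e' : E} {a : Path e₀ e} {b : Path e₀ e'} (ha : ∀ t, p (a t) = α t)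
    (hb : ∀ t, p (b t) = β t) : e = e' := by
  obtain ⟨F⟩ := hαβ
  obtain ⟨G, ⟨hG₀, hG⟩, -⟩ := h.existsUnique_lift_of_contractible (y₀ := ((0, 0) : I × I))
    F.toContinuousMap (F.source 0)
  have hGF (s t) : p (G (s, t)) = F (s, t) := DFunLike.congr_fun hG (s, t)
  let side (t : I) : C(I, E) := ⟨fun s => G (s, t), by fun_prop⟩
  let row (s : I) : C(I, E) := ⟨fun t => G (s, t), by fun_prop⟩
  have hside₀ : side 0 = ContinuousMap.const I (G (0, 0)) :=
    h.eq_of_comp_eq rfl fun s => by simp [side, hGF]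
  have hside₁ : side 1 = ContinuousMap.const I (G (0, 1)) :=
    h.eq_of_comp_eq rfl fun s => by simp [side, hGF]
  have hrow₀ : row 0 = a.toContinuousMap :=
    h.eq_of_comp_eq_of_base hG₀ a.source fun t => by simp [row, hGF, ha]
  have hrow₁ : row 1 = b.toContinuousMap :=
    h.eq_of_comp_eq_of_base ((DFunLike.congr_fun hside₀ 1).trans hG₀) b.source fun t => by
      simp [row, hGF, hb]
  calc e = row 0 1 := a.target.symm.trans (DFunLike.congr_fun hrow₀ 1).symm
    _ = row 1 1 := (DFunLike.congr_fun hside₁ 1).symm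
    _ = e' := (DFunLike.congr_fun hrow₁ 1).trans b.target

theorem eq_of_forall_eventually_mem (h : HasUniqueLiftingProperty p e₀ x₀ hp) {ι : Type u}
    {l : Filter ι} [l.NeBot] {e₁ : E} (he₁ : p e₁ = x₀) (η : ι → Path e₀ e₁)
    (hη : ∀ U ∈ 𝓝 x₀, ∀ᶠ i in l, ∀ t, p (η i t) ∈ U) : e₁ = e₀ := by
  have : Nonempty ι := l.nonempty_of_neBot
  let i₀ : ι := Classical.arbitrary ι
  have hstart (i) : p (η i 0) = x₀ := by rw [(η i).source, hp]
  let f : C(Hedgehog l, X) := ⟨fun z => p (η z.1 z.2),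
    Hedgehog.continuous_of_forall_eventually_mem (f := fun i t => p (η i t))
      (fun i => by fun_prop) hstart hη⟩
  obtain ⟨g, ⟨hg₀, hg⟩, -⟩ := h.existsUnique_lift (y₀ := Hedgehog.mk l i₀ 0) f (hstart i₀)
  have hpg (i t) : p (g (Hedgehog.mk l i t)) = p (η i t) := DFunLike.congr_fun hg _
  have hg_zero (i) : g (Hedgehog.mk l i 0) = e₀ := by
    have hs := ((Hedgehog.inseparable_mk_zero i i₀).map g.continuous).specializes
    rw [hg₀] at hs
    exact h.eq_of_specializes hs (by rw [hpg, hstart, hp])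
  have hg_one (i) : g (Hedgehog.mk l i 1) = e₁ := by
    have hgη : g.comp ⟨Hedgehog.mk l i, Hedgehog.continuous_mk i⟩ = (η i).toContinuousMap :=
      h.eq_of_comp_eq_of_base (hg_zero i) (η i).source (hpg i)
    exact (DFunLike.congr_fun hgη 1).trans (η i).target
  have hlim : Tendsto (fun _ => e₁) l (𝓝 e₀) := by
    simpa only [Function.comp_def, hg_one, hg₀] using
      (g.continuous.tendsto _).comp (Hedgehog.tendsto_mk i₀ 1)
  refine h.eq_of_specializes (specializes_iff_forall_open.2 fun W hW he₀ => ?_) (he₁.trans hp.symm)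
  exact eventually_const.1 (hlim.eventually_mem (hW.mem_nhds he₀))

theorem eq_of_forall_exists_path (h : HasUniqueLiftingProperty p e₀ x₀ hp) {e₁ : E}
    (he₁ : p e₁ = x₀) (hsmall : ∀ U ∈ 𝓝 x₀, ∃ η : Path e₀ e₁, ∀ t, p (η t) ∈ U) : e₁ = e₀ := by
  let l : Filter (Path e₀ e₁) := (𝓝 x₀).smallSets.comap fun η => range (p ∘ η)
  have : l.NeBot := by
    refine comap_neBot_iff.2 fun s hs => ?_
    obtain ⟨U, hU, hUs⟩ := eventually_smallSets.1 hs
    obtain ⟨η, hη⟩ := hsmall U hU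
    exact ⟨η, hUs _ (range_subset_iff.2 hη)⟩
  refine h.eq_of_forall_eventually_mem (l := l) he₁ id fun U hU => ?_
  exact (tendsto_comap.eventually (eventually_smallSets_subset.2 hU)).mono fun η =>
    range_subset_iff.1

end HasUniqueLiftingProperty

end UniqueLifting

section SmallLoops

/-- The subgroup of `π₁(X, x₀)` of the classes of loops in `U`. -/
def smallLoopSubgroup {X : Type*} [TopologicalSpace X] (x₀ : X) {U : Set X} (hU : x₀ ∈ U) :
    Subgroup (FundamentalGroup X x₀) where
  carrier := {g | ∃ γ : Path x₀ x₀, range γ ⊆ U ∧ g = Path.Homotopic.Quotient.mk γ}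
  one_mem' := ⟨Path.refl x₀, by simpa using hU, rfl⟩
  mul_mem' := by
    rintro _ _ ⟨γ, hγ, rfl⟩ ⟨δ, hδ, rfl⟩
    exact ⟨δ.trans γ, by rw [Path.trans_range]; exact union_subset hδ hγ, rfl⟩
  inv_mem' := by
    rintro _ ⟨γ, hγ, rfl⟩
    exact ⟨γ.symm, by rwa [Path.symm_range], rfl⟩

variable {X : Type u} [TopologicalSpace X] {x₀ : X}

theorem StrongSLTAt.absorbsSmallLoops_normalCore (hX : StrongSLTAt X x₀) {U : Set X}
    (hU : U ∈ 𝓝 x₀) :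
    AbsorbsSmallLoops (smallLoopSubgroup x₀ (mem_of_mem_nhds hU)).normalCore := by
  intro x
  obtain ⟨V, hV, h⟩ := hX x U hU
  refine ⟨V, hV, fun α β hβ g => ?_⟩
  obtain ⟨c, rfl⟩ := Path.Homotopic.Quotient.mk_surjective g
  obtain ⟨γ, hγ, hγ'⟩ := h (c.symm.trans α) β hβ
  refine ⟨γ, hγ, ?_⟩
  rw [Path.Homotopic.Quotient.eq.2 hγ', Path.trans_symm, Path.symm_symm]
  simp only [FundamentalGroup.mul_def, FundamentalGroup.inv_def, loopClass,
    Path.Homotopic.Quotient.mk_trans, Path.Homotopic.Quotient.mk_symm,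
    Path.Homotopic.Quotient.trans_assoc]

theorem IsCoveringSubgroup.absorbsSmallLoops {K : Subgroup (FundamentalGroup X x₀)}
    (hK : IsCoveringSubgroup x₀ K) : AbsorbsSmallLoops K := by
  obtain ⟨E, _, p, e₀, hp, _, cov, rfl⟩ := hK
  exact absorbsSmallLoops_range_of_isCoveringMap hp cov

variable {E : Type u} [TopologicalSpace E] [PathConnectedSpace E] {p : C(E, X)} {e₀ : E}
  {hp : p e₀ = x₀}

theorem HasUniqueLiftingProperty.exists_mem_forall_exists_path_lift
    (h : HasUniqueLiftingProperty p e₀ x₀ hp) {N : Subgroup (FundamentalGroup X x₀)} [N.Normal]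
    {g : FundamentalGroup X x₀} (hg : g ∈ (FundamentalGroup.mapOfEq p hp).range ⊔ N)
    {α : Path x₀ x₀} (hα : Path.Homotopic.Quotient.mk α = g) {e₁ : E} {a : Path e₀ e₁}
    (ha : ∀ t, p (a t) = α t) :
    ∃ n ∈ N, ∀ δ : Path x₀ x₀, n = Path.Homotopic.Quotient.mk δ →
      ∃ d : Path e₀ e₁, ∀ t, p (d t) = δ t := by
  rw [sup_comm, Subgroup.mem_sup_of_normal_left] at hg
  obtain ⟨n, hn, k, hk, rfl⟩ := hg
  refine ⟨n, hn, ?_⟩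
  rintro δ rfl
  obtain ⟨η, γ, rfl, hη⟩ := mem_range_mapOfEq_iff.1 hk
  obtain ⟨e, d, hd⟩ := h.exists_path_lift δ
  have hγδ : α.Homotopic (γ.trans δ) := Path.Homotopic.Quotient.eq.1 hα
  obtain rfl : e₁ = e := h.eq_of_homotopic hγδ ha (apply_trans_eq_trans_apply hη hd)
  exact ⟨d, hd⟩

theorem HasUniqueLiftingProperty.iInf_range_sup_normalCore
    (h : HasUniqueLiftingProperty p e₀ x₀ hp) :
    ⨅ U : {U : Set X // U ∈ 𝓝 x₀}, (FundamentalGroup.mapOfEq p hp).range ⊔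
      (smallLoopSubgroup x₀ (mem_of_mem_nhds U.2)).normalCore =
        (FundamentalGroup.mapOfEq p hp).range := by
  refine le_antisymm (fun g hg => ?_) (le_iInf fun _ => le_sup_left)
  obtain ⟨α, hα⟩ := Path.Homotopic.Quotient.mk_surjective g
  obtain ⟨e₁, a, ha⟩ := h.exists_path_lift α
  have he₁ : p e₁ = x₀ := by rw [← a.target, ha, α.target]
  obtain rfl : e₁ = e₀ := h.eq_of_forall_exists_path he₁ fun U hU => by
    obtain ⟨n, hn, hlift⟩ :=
      h.exists_mem_forall_exists_path_lift (Subgroup.mem_iInf.1 hg ⟨U, hU⟩) hα ha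
    obtain ⟨δ, hδ, hnδ⟩ := Subgroup.normalCore_le _ hn
    obtain ⟨d, hd⟩ := hlift δ hnδ
    exact ⟨d, fun t => hd t ▸ hδ (mem_range_self t)⟩
  exact mem_range_mapOfEq_iff.2 ⟨a, α, hα, ha⟩

end SmallLoops

section Main

variable {X E : Type u} [TopologicalSpace X] [LocallyPathConnectedSpace X] [TopologicalSpace E]
  {x₀ : X} {p : C(E, X)} {e₀ : E} {hp : p e₀ = x₀}

theorem IsGeneralizedCovering.exists_range_eq_sInf (h : IsGeneralizedCovering p e₀ x₀ hp)
    (hX : StrongSLTAt X x₀) :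
    ∃ S : Set (Subgroup (FundamentalGroup X x₀)), S.Nonempty ∧
      (∀ K ∈ S, IsCoveringSubgroup x₀ K) ∧ (FundamentalGroup.mapOfEq p hp).range = sInf S := by
  have := h.connectedSpace
  have := h.locallyPathConnectedSpace
  have : PathConnectedSpace E := .of_locallyPathConnectedSpace
  have : Nonempty {U : Set X // U ∈ 𝓝 x₀} := ⟨⟨univ, univ_mem⟩⟩
  refine ⟨_, range_nonempty _, ?_, h.uniqueLifting.iInf_range_sup_normalCore.symm⟩
  rintro _ ⟨U, rfl⟩
  exact isCoveringSubgroup_of_absorbsSmallLoops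
    ((hX.absorbsSmallLoops_normalCore U.2).mono le_sup_right)

end Main

end

theorem theorem41_general (X : Type u) [TopologicalSpace X] [LocallyPathConnectedSpace X]
    (x₀ : X) (hX : StrongSLTAt X x₀) (H : Subgroup (FundamentalGroup X x₀)) :
    (∃ (E : Type u) (_ : TopologicalSpace E) (p : C(E, X)) (e₀ : E) (hp : p e₀ = x₀),
        IsGeneralizedCovering p e₀ x₀ hp ∧ (FundamentalGroup.mapOfEq p hp).range = H) ↔
      ∃ S : Set (Subgroup (FundamentalGroup X x₀)),
        S.Nonempty ∧ (∀ K ∈ S, IsCoveringSubgroup x₀ K) ∧ H = sInf S := by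
  constructor
  · rintro ⟨E, _, p, e₀, hp, hE, rfl⟩
    exact hE.exists_range_eq_sInf hX
  · rintro ⟨S, -, hS, rfl⟩
    have hS' : ∀ K ∈ S, AbsorbsSmallLoops K := fun K hK => (hS K hK).absorbsSmallLoops
    exact ⟨_, _, _, _, _, isGeneralizedCovering_projMap_sInf hS',
      WhiskerSpace.range_projMap_sInf hS'⟩

theorem theorem41 (X : Type u) [TopologicalSpace X] [ConnectedSpace X] [LocallyPathConnectedSpace X]
    (x₀ : X) (hX : StrongSLTAt X x₀) (H : Subgroup (FundamentalGroup X x₀)) :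
    (∃ (E : Type u) (_ : TopologicalSpace E) (p : C(E, X)) (e₀ : E) (hp : p e₀ = x₀),
        IsGeneralizedCovering p e₀ x₀ hp ∧ (FundamentalGroup.mapOfEq p hp).range = H) ↔
      ∃ S : Set (Subgroup (FundamentalGroup X x₀)),
        S.Nonempty ∧ (∀ K ∈ S, IsCoveringSubgroup x₀ K) ∧ H = sInf S :=
  theorem41_general X x₀ hX H
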